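/- Let $\Bbbk$ be an algebraically closed field of characteristic zero, $N\ge 1$ an integer, $H=\Bbbk[D]$, and let $V_N=H\otimes\Bbbk^N$ be the free $H$-module of rank $N$. Let $\mathrm{Cend}_N=H\otimes M_N(\Bbbk[v])=M_N(\Bbbk[D,v])$ be the associative conformal algebra of conformal endomorphisms of $V_N$. Its $n$-th products ($n\ge 0$) are determined by $A(v)\circ_n B(v)=A(v)\,\partial_v^n B(v)$ for $A,B\in M_N(\Bbbk[v])$ together with $(Da)\circ_n b=-n\,a\circ_{n-1}b$ and $a\circ_n(Db)=D(a\circ_n b)+n\,a\circ_{n-1}b$. An element $a=\sum_s \frac{(-D)^s}{s!}\otimes A_s(v)$ acts on $V_N$ by the operators $a_n u=\sum_{s}\binom{n}{s}A_s(D)\,\partial_D^{\,n-s}u$, $n\ge 0$. A conformal subalgebra is an $H$-submodule $C\subseteq \mathrm{Cend}_N$ closed under all products $\circ_n$. It is irreducible if the only $H$-submodules $U\subseteq V_N$ with $a_nU\subseteq U$ for all $a\in C$, $n\ge 0$ are $0$ and $V_N$. Theorem. Let $C\subseteq \mathrm{Cend}_N$ be an irreducible conformal subalgebra with $C\cap vC\neq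 0$, where $vC=\{va\mid a\in C\}$. Then there is a matrix $Q\in M_N(\Bbbk[v])$ with $\det Q\ne 0$ such that $$C=\mathrm{Cend}_{N,Q}:=M_N(\Bbbk[D,v])\,Q(-D+v).$$ -/

import Mathlib

open Polynomial

noncomputable section

/-- The free `N`-generated module `V_N = H ⊗ 𝕜^N` over `H = 𝕜[D]`; the variable is `D`. -/
abbrev VN (k : Type*) [Field k] (N : ℕ) : Type _ := Fin N → k[X]

/-- The underlying space `H ⊗ M_N(𝕜[v]) = M_N(𝕜[D, v])` of `Cend_N`.  The entries are
polynomials in the outer variable `D` whose coefficients are polynomials in the inner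
variable `v`. -/
abbrev CendN (k : Type*) [Field k] (N : ℕ) : Type _ := Matrix (Fin N) (Fin N) k[X][X]

namespace CendN

variable {k : Type*} [Field k] {N : ℕ}

/-- The variable `D` of `𝕜[D, v]`. -/
def varD (k : Type*) [Field k] : k[X][X] := X

/-- The variable `v` of `𝕜[D, v]`. -/
def varv (k : Type*) [Field k] : k[X][X] := C X

/-- The derivation `∂_v` of `𝕜[D, v]`, which differentiates the coefficients. -/
def derivV (k : Type*) [Field k] : k[X][X] →ₗ[k] k[X][X] where
  toFun f := ∑ s ∈ f.support, monomial s (derivative (f.coeff s))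
  map_add' f g := by
    have key : ∀ (h : k[X][X]) (m : ℕ),
        (∑ s ∈ h.support, monomial s (derivative (h.coeff s))).coeff m
          = derivative (h.coeff m) := by
      intro h m
      simp only [finsetSum_coeff, coeff_monomial, Finset.sum_ite_eq', mem_support_iff]
      split_ifs <;> simp_all
    ext1 m
    rw [coeff_add, key, key, key, coeff_add, derivative_add]
  map_smul' c f := by
    ext1 m
    simp only [finsetSum_coeff, coeff_monomial, Finset.sum_ite_eq', mem_support_iff, coeff_smul,
      RingHom.id_apply]
    split_ifs <;> simp_all

theorem derivV_coeff (f : k[X][X]) (m : ℕ) :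
    (derivV k f).coeff m = derivative (f.coeff m) := by
  simp only [derivV, LinearMap.coe_mk, AddHom.coe_mk, finsetSum_coeff, coeff_monomial,
    Finset.sum_ite_eq', mem_support_iff]
  split_ifs <;> simp_all

/-- The derivation `∂_D + ∂_v` of `𝕜[D, v]`. -/
def dTotal (k : Type*) [Field k] : k[X][X] →ₗ[k] k[X][X] :=
  (derivative : k[X][X] →ₗ[k[X]] k[X][X]).restrictScalars k + derivV k

/-- The matrix `A_s ∈ M_N(𝕜[v])` in `a = ∑_s D^s ⊗ A_s(v)`. -/
def coeffD (a : CendN k N) (s : ℕ) : Matrix (Fin N) (Fin N) k[X] := a.map fun f => f.coeff s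

/-- The inclusion `A ↦ 1 ⊗ A` of `M_N(𝕜[v])` into `Cend_N`. -/
def ofMat (A : Matrix (Fin N) (Fin N) k[X]) : CendN k N := A.map C

/-- The `n`-th product of `Cend_N`.  It is the unique biadditive family with
`A(v) ∘ₙ B(v) = A(v) ∂_v^n B(v)` that is sesquilinear over `H` (see `prod_ofMat`, `prod_D_left_zero`,
`prod_D_left` and `prod_D_right`).  Explicitly `(D^s ⊗ A) ∘ₙ b = (-1)^s n(n-1)⋯(n-s+1) A (∂_D + ∂_v)^(n-s) b`;
the terms with `s > n` vanish. -/
def prod (n : ℕ) (a b : CendN k N) : CendN k N :=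
  ∑ s ∈ Finset.range (n + 1),
    ((-1) ^ s * (n.descFactorial s : k)) •
      (ofMat (coeffD a s) * b.map ((dTotal k) ^ (n - s)))

theorem prod_add_left (n : ℕ) (a a' b : CendN k N) :
    prod n (a + a') b = prod n a b + prod n a' b := by
  have h : ∀ s, ofMat (coeffD (a + a') s) = ofMat (coeffD a s) + ofMat (coeffD a' s) := by
    intro s; ext i j : 2; simp [ofMat, coeffD]
  simp [prod, h, add_mul, Finset.sum_add_distrib]

theorem prod_add_right (n : ℕ) (a b b' : CendN k N) :
    prod n a (b + b') = prod n a b + prod n a b' := by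
  simp [prod, Matrix.map_add, mul_add, Finset.sum_add_distrib]

theorem dTotal_pow_C (n : ℕ) (f : k[X]) : (dTotal k ^ n) (C f) = C (derivative^[n] f) := by
  induction n generalizing f with
  | zero => simp
  | succ n ih =>
    have h : dTotal k (C f) = C (derivative f) := by
      ext1 m
      simp only [dTotal, LinearMap.add_apply, LinearMap.restrictScalars_apply, derivative_C,
        zero_add, derivV_coeff, coeff_C]
      split_ifs <;> simp
    rw [pow_succ, Module.End.mul_apply, h, ih, Function.iterate_succ_apply]

theorem dTotal_pow_D (n : ℕ) (f : k[X][X]) :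
    (dTotal k ^ n) (varD k * f)
      = varD k * (dTotal k ^ n) f + (n : k[X][X]) * (dTotal k ^ (n - 1)) f := by
  have h1 : ∀ g : k[X][X], dTotal k (varD k * g) = varD k * dTotal k g + g := by
    intro g
    have h2 : derivV k (varD k * g) = varD k * derivV k g := by
      ext1 m
      cases m <;> simp [derivV_coeff, varD, coeff_X_mul, mul_coeff_zero]
    simp only [dTotal, LinearMap.add_apply, h2, LinearMap.restrictScalars_apply]
    simp only [varD, derivative_mul, derivative_X]
    ring
  have h3 : ∀ (m : ℕ) (g : k[X][X]), dTotal k ((m : k[X][X]) * g) = (m : k[X][X]) * dTotal k g := by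
    intro m g
    rw [← nsmul_eq_mul, map_nsmul, nsmul_eq_mul]
  induction n with
  | zero => simp
  | succ n ih =>
    rw [pow_succ', Module.End.mul_apply, ih, map_add, h1, h3]
    rcases n with _ | n
    · simp
    · simp only [Nat.add_sub_cancel, pow_succ', Module.End.mul_apply]
      push_cast
      ring

/-- `A(v) ∘ₙ B(v) = A(v) ∂_v^n B(v)`. -/
theorem prod_ofMat (n : ℕ) (A B : Matrix (Fin N) (Fin N) k[X]) :
    prod n (ofMat A) (ofMat B) = ofMat (A * B.map (fun f => derivative^[n] f)) := by
  unfold prod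
  rw [Finset.sum_eq_single_of_mem 0 (by simp)]
  · have h0 : coeffD (ofMat A) 0 = A := by ext i j : 2; simp [coeffD, ofMat]
    rw [h0]
    have h1 : (ofMat B).map ((dTotal k) ^ n) = ofMat (B.map (fun f => derivative^[n] f)) := by
      ext i j : 2; simp [ofMat, dTotal_pow_C]
    rw [Nat.sub_zero, h1]
    simp only [ofMat, Matrix.map_mul, pow_zero, Nat.descFactorial_zero, Nat.cast_one, mul_one,
      one_smul]
  · intro s _ hs
    have h0 : coeffD (ofMat A) s = 0 := by
      ext i j : 2; simp [coeffD, ofMat, coeff_C, hs]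
    have h1 : ofMat (0 : Matrix (Fin N) (Fin N) k[X]) = 0 := by
      ext i j : 2; simp [ofMat]
    rw [h0, h1, zero_mul, smul_zero]

/-- `Da ∘₀ b = 0`. -/
theorem prod_D_left_zero (a b : CendN k N) : prod 0 (varD k • a) b = 0 := by
  have h : coeffD (varD k • a) 0 = 0 := by
    ext i j : 2; simp [coeffD, varD]
  simp [prod, h, ofMat]

/-- `Da ∘ₙ b = -n (a ∘ₙ₋₁ b)`. -/
theorem prod_D_left (n : ℕ) (a b : CendN k N) :
    prod (n + 1) (varD k • a) b = -((n : k) + 1) • prod n a b := by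
  have h0 : coeffD (varD k • a) 0 = 0 := by
    ext i j : 2; simp [coeffD, varD]
  have h : ∀ s, coeffD (varD k • a) (s + 1) = coeffD a s := by
    intro s; ext i j : 2; simp [coeffD, varD, coeff_X_mul]
  unfold prod
  rw [Finset.sum_range_succ', h0, Finset.smul_sum]
  simp only [h, Nat.succ_descFactorial_succ, smul_smul, Nat.add_sub_add_right]
  simp only [ofMat, Matrix.map_zero, map_zero, zero_mul, smul_zero, add_zero]
  refine Finset.sum_congr rfl fun s _ => ?_
  congr 1
  push_cast
  ring

/-- `a ∘ₙ Db = D(a ∘ₙ b) + n (a ∘ₙ₋₁ b)`. -/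
theorem prod_D_right (n : ℕ) (a b : CendN k N) :
    prod n a (varD k • b) = varD k • prod n a b + (n : k) • prod (n - 1) a b := by
  have h : ∀ m : ℕ, (varD k • b).map ((dTotal k : k[X][X] →ₗ[k] k[X][X]) ^ m)
      = varD k • b.map ((dTotal k : k[X][X] →ₗ[k] k[X][X]) ^ m) +
        (m : k) • b.map ((dTotal k : k[X][X] →ₗ[k] k[X][X]) ^ (m - 1)) := by
    intro m
    ext i j : 2
    simp only [Matrix.map_apply, Matrix.smul_apply, Matrix.add_apply, smul_eq_mul, dTotal_pow_D]
    rw [← nsmul_eq_mul, Nat.cast_smul_eq_nsmul]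
  have e1 : ∀ s ∈ Finset.range (n + 1),
      ((-1) ^ s * (n.descFactorial s : k)) •
        (ofMat (coeffD a s) * (varD k • b).map ((dTotal k) ^ (n - s)))
      = varD k • (((-1) ^ s * (n.descFactorial s : k)) •
          (ofMat (coeffD a s) * b.map ((dTotal k) ^ (n - s))))
        + ((-1) ^ s * (n.descFactorial s : k) * ((n - s : ℕ) : k)) •
          (ofMat (coeffD a s) * b.map ((dTotal k) ^ (n - s - 1))) := by
    intro s _
    rw [h, Matrix.mul_add, smul_add, Matrix.mul_smul, Matrix.mul_smul, smul_smul]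
    congr 1
    ext i j : 2
    simp only [Matrix.smul_apply, smul_eq_mul, mul_smul_comm]
  have e2 : ∑ s ∈ Finset.range (n + 1),
      ((-1) ^ s * (n.descFactorial s : k) * ((n - s : ℕ) : k)) •
        (ofMat (coeffD a s) * b.map ((dTotal k) ^ (n - s - 1))) = (n : k) • prod (n - 1) a b := by
    rcases n with _ | n
    · simp
    · rw [Finset.sum_range_succ, Nat.sub_self, Nat.cast_zero, mul_zero, zero_smul, add_zero,
        Nat.add_sub_cancel, prod, Finset.smul_sum]
      refine Finset.sum_congr rfl fun s hs => ?_
      have hs' : s ≤ n := by simpa [Nat.lt_succ_iff] using hs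
      have e : n + 1 - s - 1 = n - s := by omega
      have e3 : ((n + 1).descFactorial s : k) * ((n + 1 - s : ℕ) : k)
          = ((n + 1 : ℕ) : k) * (n.descFactorial s : k) := by
        rw [← Nat.cast_mul, ← Nat.cast_mul, mul_comm, ← Nat.descFactorial_succ,
          Nat.succ_descFactorial_succ]
      rw [e, smul_smul, mul_assoc, e3]
      congr 1
      ring
  rw [← e2, prod, Finset.sum_congr rfl e1, Finset.sum_add_distrib, prod, Finset.smul_sum]

/-- The action of the `n`-th component of the conformal endomorphism `a` of `V_N`: for
`a = ∑_s (-D)^s / s! ⊗ A_s(v)` it is `u ↦ ∑_s (n choose s) A_s(D) ∂_D^(n-s) u`, that is,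
for `a = ∑_s D^s ⊗ A_s(v)` it is `u ↦ ∑_s (-1)^s n(n-1)⋯(n-s+1) A_s(D) ∂_D^(n-s) u`. -/
def act (a : CendN k N) (n : ℕ) (u : VN k N) : VN k N :=
  ∑ s ∈ Finset.range (n + 1),
    ((-1) ^ s * (n.descFactorial s : k)) •
      (coeffD a s).mulVec (fun i => derivative^[n - s] (u i))

/-- A conformal subalgebra of `Cend_N`: an `H`-submodule closed under all `n`-th products. -/
structure IsConformalSubalgebra (S : Submodule k (CendN k N)) : Prop where
  D_mem : ∀ a ∈ S, varD k • a ∈ S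
  prod_mem : ∀ a ∈ S, ∀ b ∈ S, ∀ n : ℕ, prod n a b ∈ S

/-- `S` is irreducible: `V_N` has no `S`-submodules except `0` and `V_N`, where an `S`-submodule
is an `H`-submodule invariant under all the operators `a_n`, `a ∈ S`. -/
def IsIrreducible (S : Submodule k (CendN k N)) : Prop :=
  ∀ U : Submodule k[X] (VN k N),
    (∀ a ∈ S, ∀ n : ℕ, ∀ u ∈ U, act a n u ∈ U) → U = ⊥ ∨ U = ⊤

/-- The subspace `vS` of `Cend_N`. -/
def vMul (S : Submodule k (CendN k N)) : Submodule k (CendN k N) :=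
  S.map (LinearMap.lsmul k[X][X] (CendN k N) (varv k) |>.restrictScalars k)

/-- The substitution `Q(v) ↦ Q(-D ⊗ 1 + 1 ⊗ v)`. -/
def shift (Q : Matrix (Fin N) (Fin N) k[X]) : CendN k N :=
  Q.map fun f => aeval (-varD k + varv k) f

/-- `Cend_{N,Q} = M_N(𝕜[D, v]) Q(-D + v)`. -/
def leftIdeal (Q : Matrix (Fin N) (Fin N) k[X]) : Submodule k (CendN k N) :=
  LinearMap.range (LinearMap.mulRight k (shift Q))

end CendN

end

/-!
The proof rests on the coordinate `w = v - D`. Written in the variables `v` and `w`, the element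
`b` of `Cend_N` has as coefficients of the monomials `w^j` matrices over `𝕜[v]`, whose columns are
vectors of `V_N`, and `a ∘ₙ b` is obtained by applying the operator `a_n` to each of these columns
(`wcoeff_prod`). So, as a module over the operators `a_n`, `Cend_N` is `V_N ⊗ 𝕜[w]^N`, a direct
sum of copies of `V_N`, and a conformal subalgebra `S` is a submodule of it.

If `V_N` is irreducible under the operators `a_n`, `a ∈ S`, *without* the help of multiplication
by `D`, then only scalars commute with them (`exists_eq_smul_of_commute`), so by the Jacobson
density theorem `S` is stable under every linear operator on `V_N` (`mem_of_wcoeff_eq`). Hence `S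
= V_N ⊗ E` for a subspace `E` of `𝕜[w]^N`. Such an `S` is closed under multiplication by `v`, and
by `D`, thus also by `w`; therefore `E` is a `𝕜[w]`-submodule, the row space of a square matrix
`Q`. A null vector of `Q` would be annihilated by `S`, so `det Q ≠ 0`.

What remains is to remove `D` from the irreducibility assumption. This is possible as soon as `S`
contains `v^i f` for all `i` and some `f ≠ 0`: such `f` form a two-sided ideal, and the images of
its operators on a nonzero `S`-invariant subspace `U` span a nonzero `S`-invariant subspace of `U`
that is closed under multiplication by `D`, so it is `V_N` (`eq_bot_or_top_of_invariant`). The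
hypothesis on `S ∩ vS` gives `a ≠ 0` in `S` with `va ∈ S`. Multiplying by elements of this kind
produces, for every `m`, an element `f ≠ 0` with `f, vf, …, v^m f ∈ S`. If one multiplies on the
right, by elements of bounded degree in `w`, and always takes the highest nonzero product, then
the degrees of `f` in `v` and in `w` do not grow (`exists_ne_zero_mem_vPowClosed_succ`). The
spaces of such `f` are thus a decreasing chain of nonzero finite-dimensional spaces, so they have
a common nonzero element.
-/

namespace CendN

variable {k : Type*} [Field k] {N : ℕ}

/-! ### The operators `a_n` on `V_N` -/

/-- The operator `∂_D` on `V_N`, acting on each coordinate. -/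
noncomputable def dVec (k : Type*) [Field k] (N : ℕ) : VN k N →ₗ[k] VN k N where
  toFun u i := derivative (u i)
  map_add' u v := by ext1 i; simp
  map_smul' c u := by ext1 i; simp

theorem dVec_apply (u : VN k N) (i : Fin N) : dVec k N u i = derivative (u i) := rfl

theorem dVec_pow_apply (n : ℕ) (u : VN k N) (i : Fin N) :
    (dVec k N ^ n) u i = derivative^[n] (u i) := by
  induction n with
  | zero => rfl
  | succ n ih => rw [pow_succ', Module.End.mul_apply, dVec_apply, ih, Function.iterate_succ_apply']

theorem dVec_mulVec (A : Matrix (Fin N) (Fin N) k[X]) (u : VN k N) :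
    dVec k N (A.mulVec u) = (A.map derivative).mulVec u + A.mulVec (dVec k N u) := by
  ext1 i
  simp [dVec_apply, Matrix.mulVec, dotProduct, Finset.sum_add_distrib]

theorem dVec_X_smul (u : VN k N) :
    dVec k N ((X : k[X]) • u) = (X : k[X]) • dVec k N u + u := by
  ext1 i
  simp [dVec_apply, add_comm]

/-- The derivation `∂_D + ∂_v` of `Cend_N`, acting on each matrix entry. -/
noncomputable def dT (k : Type*) [Field k] (N : ℕ) : CendN k N →ₗ[k] CendN k N :=
  (dTotal k).mapMatrix

theorem dT_apply (a : CendN k N) (i j : Fin N) : dT k N a i j = dTotal k (a i j) := rfl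

theorem coeffD_add (a b : CendN k N) (s : ℕ) : coeffD (a + b) s = coeffD a s + coeffD b s := by
  ext i j : 2; simp [coeffD]

theorem coeffD_smul (c : k) (a : CendN k N) (s : ℕ) : coeffD (c • a) s = c • coeffD a s := by
  ext i j : 2; simp [coeffD]

theorem coeffD_v_smul (a : CendN k N) (s : ℕ) :
    coeffD (varv k • a) s = (X : k[X]) • coeffD a s := by
  ext i j : 2; simp [coeffD, varv]

theorem coeffD_dT (a : CendN k N) (s : ℕ) :
    coeffD (dT k N a) s = ((s + 1 : ℕ) : k) • coeffD a (s + 1) + (coeffD a s).map derivative := by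
  ext i j : 2
  simp only [coeffD, Matrix.map_apply, dT_apply, dTotal, LinearMap.add_apply, coeff_add,
    LinearMap.restrictScalars_apply, coeff_derivative, derivV_coeff, Matrix.add_apply,
    Matrix.smul_apply]
  rw [Nat.cast_smul_eq_nsmul, nsmul_eq_mul, mul_comm]
  push_cast
  rfl

theorem act_eq (a : CendN k N) (n : ℕ) (u : VN k N) :
    act a n u = ∑ s ∈ Finset.range (n + 1), ((-1) ^ s * (n.descFactorial s : k)) •
      (coeffD a s).mulVec ((dVec k N ^ (n - s)) u) := by
  refine Finset.sum_congr rfl fun s _ => ?_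
  congr 2
  ext1 i
  rw [dVec_pow_apply]

theorem act_zero_index (a : CendN k N) (u : VN k N) : act a 0 u = (coeffD a 0).mulVec u := by
  simp [act]

theorem act_add_left (a b : CendN k N) (n : ℕ) (u : VN k N) :
    act (a + b) n u = act a n u + act b n u := by
  simp only [act, coeffD_add, Matrix.add_mulVec, smul_add, Finset.sum_add_distrib]

theorem act_smul_left (c : k) (a : CendN k N) (n : ℕ) (u : VN k N) :
    act (c • a) n u = c • act a n u := by
  simp only [act, coeffD_smul, Matrix.smul_mulVec, Finset.smul_sum]
  exact Finset.sum_congr rfl fun s _ => smul_comm _ _ _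

theorem act_zero_left (n : ℕ) (u : VN k N) : act (0 : CendN k N) n u = 0 := by
  simpa using act_smul_left (0 : k) 0 n u

/-- The operator `a_n` as a linear map. -/
noncomputable def actL (a : CendN k N) (n : ℕ) : VN k N →ₗ[k] VN k N where
  toFun := act a n
  map_add' u v := by
    simp only [act_eq, map_add, Matrix.mulVec_add, smul_add, Finset.sum_add_distrib]
  map_smul' c u := by
    simp only [act_eq, map_smul, Matrix.mulVec_smul, Finset.smul_sum, RingHom.id_apply]
    exact Finset.sum_congr rfl fun s _ => smul_comm _ _ _

theorem actL_apply (a : CendN k N) (n : ℕ) (u : VN k N) : actL a n u = act a n u := rfl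

theorem act_v_smul (a : CendN k N) (n : ℕ) (u : VN k N) :
    act (varv k • a) n u = (X : k[X]) • act a n u := by
  simp only [act, coeffD_v_smul, Matrix.smul_mulVec, Finset.smul_sum]
  exact Finset.sum_congr rfl fun s _ => smul_comm _ _ _

/-- The Leibniz rule `∂ a_n = a_{n+1} + (∂a)_n`, where `∂` acts on `Cend_N` by `∂_D + ∂_v`. -/
theorem dVec_act (a : CendN k N) (n : ℕ) (u : VN k N) :
    dVec k N (act a n u) = act a (n + 1) u + act (dT k N a) n u := by
  have e1 : dVec k N (act a n u) =
      ∑ s ∈ Finset.range (n + 1), ((-1) ^ s * (n.descFactorial s : k)) •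
        ((coeffD a s).map derivative).mulVec ((dVec k N ^ (n - s)) u) +
      ∑ s ∈ Finset.range (n + 1 + 1), ((-1) ^ s * (n.descFactorial s : k)) •
        (coeffD a s).mulVec ((dVec k N ^ (n + 1 - s)) u) := by
    rw [Finset.sum_range_succ _ (n + 1), Nat.descFactorial_of_lt (Nat.lt_succ_self n), act_eq,
      map_sum]
    simp only [map_smul, dVec_mulVec, Nat.cast_zero, mul_zero, zero_smul, add_zero, smul_add,
      Finset.sum_add_distrib]
    congr 1
    refine Finset.sum_congr rfl fun s hs => ?_
    rw [← Module.End.mul_apply, ← pow_succ',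
      Nat.succ_sub (Nat.lt_succ_iff.1 (Finset.mem_range.1 hs))]
  have e2 : act (dT k N a) n u =
      ∑ s ∈ Finset.range (n + 1), ((-1) ^ s * (n.descFactorial s : k) * ((s + 1 : ℕ) : k)) •
        (coeffD a (s + 1)).mulVec ((dVec k N ^ (n - s)) u) +
      ∑ s ∈ Finset.range (n + 1), ((-1) ^ s * (n.descFactorial s : k)) •
        ((coeffD a s).map derivative).mulVec ((dVec k N ^ (n - s)) u) := by
    simp only [act_eq, coeffD_dT, Matrix.add_mulVec, smul_add, Finset.sum_add_distrib,
      Matrix.smul_mulVec, smul_smul]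
  rw [e1, e2, act_eq, add_comm, ← add_assoc, add_left_inj, Finset.sum_range_succ',
    Finset.sum_range_succ' _ (n + 1), add_right_comm, ← Finset.sum_add_distrib]
  refine congrArg₂ (· + ·) (Finset.sum_congr rfl fun s hs => ?_)
    (by simp only [Nat.descFactorial_zero])
  rw [Nat.add_sub_add_right, ← add_smul]
  congr 1
  have hs' : s ≤ n := Nat.lt_succ_iff.1 (Finset.mem_range.1 hs)
  rw [Nat.succ_descFactorial_succ, Nat.descFactorial_succ]
  push_cast [Nat.cast_sub hs']
  ring

theorem act_succ (a : CendN k N) (n : ℕ) (u : VN k N) :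
    act a (n + 1) u = dVec k N (act a n u) - act (dT k N a) n u := by
  rw [dVec_act, add_sub_cancel_right]

/-- `a_n D = D a_n + n a_{n-1}`. -/
theorem act_X_smul (a : CendN k N) (n : ℕ) (u : VN k N) :
    act a n ((X : k[X]) • u) = (X : k[X]) • act a n u + (n : k) • act a (n - 1) u := by
  induction n generalizing a with
  | zero => simp [act_zero_index, Matrix.mulVec_smul]
  | succ n ih =>
    rw [act_succ, ih, ih, act_succ a n u, map_add, dVec_X_smul, map_smul]
    rcases n with _ | n
    · simp only [Nat.cast_zero, zero_smul, add_zero, zero_add, Nat.cast_one, one_smul, smul_sub,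
        Nat.sub_self]
      abel
    · simp only [Nat.add_sub_cancel, act_succ a n u]
      push_cast
      module

/-! ### The coordinate `w = v - D` -/

/-- The involution `D ↦ v - D` of `𝕜[D, v]`.  After it the outer variable stands for
`w = v - D`, while `v` is kept. -/
noncomputable def swapW (k : Type*) [Field k] : k[X][X] →ₐ[k[X]] k[X][X] :=
  aeval (C X - X)

theorem swapW_swapW (f : k[X][X]) : swapW k (swapW k f) = f := by
  have h : (swapW k).comp (swapW k) = AlgHom.id k[X] k[X][X] := by
    ext1
    simp only [swapW, AlgHom.comp_apply, aeval_X, map_sub, aeval_C, AlgHom.id_apply]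
    rw [← C_eq_algebraMap]
    ring
  exact DFunLike.congr_fun h f

theorem swapW_injective : Function.Injective (swapW k) :=
  Function.LeftInverse.injective (g := swapW k) swapW_swapW

theorem swapW_C_mul (p : k[X]) (f : k[X][X]) : swapW k (C p * f) = C p * swapW k f := by
  rw [← smul_eq_C_mul, map_smul, smul_eq_C_mul]

theorem swapW_k_smul (c : k) (f : k[X][X]) : swapW k (c • f) = c • swapW k f := by
  have h : ∀ g : k[X][X], c • g = (C c : k[X]) • g := by
    intro g
    ext1 m
    simp [smul_eq_C_mul]
  rw [h, map_smul, ← h]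

theorem derivV_mul_varv (f : k[X][X]) : derivV k (C X * f) = C X * derivV k f + f := by
  ext1 m
  simp only [derivV_coeff, coeff_C_mul, coeff_add, derivative_mul, derivative_X]
  ring

theorem derivV_mul_varD (f : k[X][X]) : derivV k (X * f) = X * derivV k f := by
  ext1 m
  cases m <;> simp [derivV_coeff, coeff_X_mul, mul_coeff_zero]

theorem swapW_dTotal (f : k[X][X]) : swapW k (dTotal k f) = derivV k (swapW k f) := by
  induction f using Polynomial.induction_on with
  | C p =>
    have h1 : dTotal k (C p) = C (derivative p) := by simpa using dTotal_pow_C 1 p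
    simp only [h1, swapW, aeval_C, ← C_eq_algebraMap]
    ext1 m
    rw [derivV_coeff, coeff_C, coeff_C]
    split_ifs <;> simp
  | add f g hf hg => rw [map_add, map_add, map_add, map_add, hf, hg]
  | monomial n p ih =>
    have h : (C p * X ^ (n + 1) : k[X][X]) = varD k * (C p * X ^ n) := by rw [varD]; ring
    have h1 := dTotal_pow_D 1 (C p * X ^ n)
    simp only [pow_one, Nat.cast_one, one_mul, Nat.sub_self, pow_zero, Module.End.one_apply] at h1
    have h2 : swapW k (varD k) = C X - X := by simp [swapW, varD]
    rw [h, h1, map_add, map_mul (swapW k), map_mul (swapW k) (varD k), h2, ih,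
      sub_mul, sub_mul, map_sub, derivV_mul_varv, derivV_mul_varD]
    ring

theorem swapW_dTotal_pow_coeff (n : ℕ) (f : k[X][X]) (j : ℕ) :
    (swapW k ((dTotal k ^ n) f)).coeff j = derivative^[n] ((swapW k f).coeff j) := by
  induction n with
  | zero => rfl
  | succ n ih =>
    rw [pow_succ', Module.End.mul_apply, swapW_dTotal, derivV_coeff, ih,
      Function.iterate_succ_apply']

/-- The `i`-th column of the coefficient of `w^j` when `a ∈ Cend_N` is expanded in powers of
`w = v - D`.  It is regarded as a vector of `V_N`, with `v` in the role of `D`. -/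
noncomputable def wcoeff (j : ℕ) (i : Fin N) : CendN k N →ₗ[k] VN k N where
  toFun a r := (swapW k (a r i)).coeff j
  map_add' a b := by ext1 r; simp
  map_smul' c a := by ext1 r; simp [swapW_k_smul]

theorem wcoeff_apply (j : ℕ) (i r : Fin N) (a : CendN k N) :
    wcoeff j i a r = (swapW k (a r i)).coeff j := rfl

theorem ext_wcoeff {a b : CendN k N} (h : ∀ j i, wcoeff j i a = wcoeff j i b) : a = b := by
  ext1 r i
  apply swapW_injective
  ext1 j
  exact congrFun (h j i) r

theorem wcoeff_v_smul (j : ℕ) (i : Fin N) (a : CendN k N) :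
    wcoeff j i (varv k • a) = (X : k[X]) • wcoeff j i a := by
  ext1 r
  simp [wcoeff_apply, varv, swapW_C_mul]

theorem wcoeff_dT (j : ℕ) (i : Fin N) (a : CendN k N) :
    wcoeff j i (dT k N a) = dVec k N (wcoeff j i a) := by
  ext1 r
  rw [wcoeff_apply, dT_apply, swapW_dTotal, derivV_coeff]
  rfl

/-- The products of `Cend_N` are the action on `V_N`, applied to the coefficients of the powers
of `w`: as a module over the operators `a_n`, `Cend_N` is a direct sum of copies of `V_N`. -/
theorem wcoeff_prod (j : ℕ) (i : Fin N) (n : ℕ) (a b : CendN k N) :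
    wcoeff j i (prod n a b) = act a n (wcoeff j i b) := by
  rw [prod, map_sum]
  refine Finset.sum_congr rfl fun s _ => ?_
  rw [map_smul]
  congr 1
  ext1 r
  simp only [wcoeff_apply, Matrix.mul_apply, ofMat, Matrix.map_apply, map_sum, swapW_C_mul,
    finsetSum_coeff, coeff_C_mul, swapW_dTotal_pow_coeff, Matrix.mulVec, dotProduct]

/-! ### Identities for the products -/

theorem prod_zero_left (n : ℕ) (b : CendN k N) : prod n 0 b = 0 :=
  ext_wcoeff fun j i => by rw [wcoeff_prod, act_zero_left, map_zero]

theorem prod_v_left (n : ℕ) (a b : CendN k N) :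
    prod n (varv k • a) b = varv k • prod n a b :=
  ext_wcoeff fun j i => by rw [wcoeff_prod, act_v_smul, wcoeff_v_smul, wcoeff_prod]

theorem prod_v_right (n : ℕ) (a b : CendN k N) :
    prod n a (varv k • b) = varv k • prod n a b + (n : k) • prod (n - 1) a b :=
  ext_wcoeff fun j i => by
    rw [wcoeff_prod, wcoeff_v_smul, act_X_smul, map_add, wcoeff_v_smul, map_smul, wcoeff_prod,
      wcoeff_prod]

theorem dT_prod (n : ℕ) (a b : CendN k N) :
    dT k N (prod n a b) = prod (n + 1) a b + prod n (dT k N a) b :=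
  ext_wcoeff fun j i => by
    rw [wcoeff_dT, wcoeff_prod, dVec_act, map_add, wcoeff_prod, wcoeff_prod]

/-- `a_n b_m = ∑_s (n choose s) (a ∘_s b)_{n+m-s}`. -/
theorem act_act (a b : CendN k N) (n m : ℕ) (u : VN k N) :
    act a n (act b m u) =
      ∑ ij ∈ Finset.HasAntidiagonal.antidiagonal n,
        n.choose ij.1 • act (prod ij.1 a b) (m + ij.2) u := by
  induction n generalizing a with
  | zero =>
    simp only [Finset.Nat.antidiagonal_zero, Finset.sum_singleton, Nat.choose_self, one_smul,
      add_zero]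
    have h : ∀ s, coeffD (prod 0 a b) s = coeffD a 0 * coeffD b s := by
      intro s
      ext1 i j
      simp [prod, coeffD, ofMat, Matrix.mul_apply]
    rw [act_zero_index]
    simp only [act, h, ← Matrix.mulVec_mulVec, Matrix.mulVec_sum, Matrix.mulVec_smul]
  | succ n ih =>
    rw [Finset.sum_antidiagonal_choose_succ_nsmul
      (fun i j => act (prod i a b) (m + j) u), act_succ, ih, ih, map_sum,
      ← Finset.sum_sub_distrib, ← Finset.sum_add_distrib]
    refine Finset.sum_congr rfl fun ij hij => ?_
    have hn : n.choose ij.2 = n.choose ij.1 :=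
      Nat.choose_symm_of_eq_add (by rw [← Finset.HasAntidiagonal.mem_antidiagonal.1 hij, add_comm])
    rw [map_nsmul, dVec_act, dT_prod, act_add_left, hn, ← smul_sub, ← smul_add, ← add_assoc m]
    congr 1
    abel

theorem exists_prod_eq_zero (a b : CendN k N) : ∃ M, ∀ n ≥ M, prod n a b = 0 := by
  obtain ⟨M₁, h₁⟩ : ∃ M, ∀ s ≥ M, coeffD a s = 0 := by
    refine ⟨(Finset.univ.sup fun p : Fin N × Fin N => (a p.1 p.2).natDegree) + 1, fun s hs => ?_⟩
    ext1 i j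
    apply coeff_eq_zero_of_natDegree_lt
    have := Finset.le_sup (f := fun p : Fin N × Fin N => (a p.1 p.2).natDegree)
      (Finset.mem_univ (i, j))
    simp only at this
    omega
  have h₂ : ∀ f : k[X][X], ∃ M, ∀ n ≥ M, (dTotal k ^ n) f = 0 := by
    intro f
    refine ⟨((swapW k f).support.sup fun j => ((swapW k f).coeff j).natDegree) + 1,
      fun n hn => swapW_injective ?_⟩
    ext1 j
    rw [swapW_dTotal_pow_coeff, map_zero, coeff_zero]
    by_cases hj : j ∈ (swapW k f).support
    · apply iterate_derivative_eq_zero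
      have := Finset.le_sup (f := fun j => ((swapW k f).coeff j).natDegree) hj
      omega
    · rw [notMem_support_iff.1 hj, iterate_derivative_zero]
  choose M₂ hM₂ using h₂
  refine ⟨M₁ + Finset.univ.sup fun p : Fin N × Fin N => M₂ (b p.1 p.2), fun n hn => ?_⟩
  refine Finset.sum_eq_zero fun s _ => ?_
  by_cases hs : M₁ ≤ s
  · have : ofMat (0 : Matrix (Fin N) (Fin N) k[X]) = 0 := by ext i j : 2; simp [ofMat]
    rw [h₁ s hs, this, zero_mul, smul_zero]
  · have : b.map ((dTotal k) ^ (n - s)) = 0 := by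
      ext1 i j
      apply hM₂
      have := Finset.le_sup (f := fun p : Fin N × Fin N => M₂ (b p.1 p.2)) (Finset.mem_univ (i, j))
      dsimp only at this
      omega
    rw [this, mul_zero, smul_zero]

/-! ### Invariant subspaces -/

/-- A `𝕜`-subspace of `V_N` that is closed under multiplication by `D`, as an `H`-submodule. -/
noncomputable def submoduleOfX (W : Submodule k (VN k N)) (h : ∀ u ∈ W, (X : k[X]) • u ∈ W) :
    Submodule k[X] (VN k N) where
  toAddSubmonoid := W.toAddSubmonoid
  smul_mem' p u hu := by
    have hC : ∀ (c : k) (w : VN k N), (C c : k[X]) • w = c • w := by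
      intro c w
      ext1 i
      simp [smul_eq_C_mul]
    induction p using Polynomial.induction_on with
    | C c => rw [hC]; exact W.smul_mem c hu
    | add p q hp hq => rw [add_smul]; exact W.add_mem hp hq
    | monomial n c ih =>
      rw [pow_succ', mul_left_comm, mul_smul]
      exact h _ ih

theorem mem_submoduleOfX {W : Submodule k (VN k N)} {h : ∀ u ∈ W, (X : k[X]) • u ∈ W}
    {u : VN k N} : u ∈ submoduleOfX W h ↔ u ∈ W := Iff.rfl

/-- The `H`-submodule of all `u` that every `a_n` sends into `U`. -/
noncomputable def transporter (a : CendN k N) (U : Submodule k[X] (VN k N)) :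
    Submodule k[X] (VN k N) :=
  submoduleOfX (⨅ n : ℕ, (U.restrictScalars k).comap (actL a n)) fun u hu => by
    simp only [Submodule.mem_iInf, Submodule.mem_comap, Submodule.restrictScalars_mem,
      actL_apply] at hu ⊢
    intro n
    rw [act_X_smul]
    exact U.add_mem (U.smul_mem _ (hu n))
      ((U.restrictScalars k).smul_mem _ (by simpa using hu (n - 1)))

theorem mem_transporter {a : CendN k N} {U : Submodule k[X] (VN k N)} {u : VN k N} :
    u ∈ transporter a U ↔ ∀ n, act a n u ∈ U := by
  simp [transporter, mem_submoduleOfX, actL_apply]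

/-- The action of `Cend_N` on `V_N` is faithful. -/
theorem eq_zero_of_act_eq_zero [CharZero k] {a : CendN k N} (h : ∀ n u, act a n u = 0) :
    a = 0 := by
  ext1 i j
  ext1 n
  have h1 := congrFun (h n (Pi.single j 1)) i
  rw [act_eq, Finset.sum_range_succ, Finset.sum_eq_zero, zero_add, Nat.sub_self, pow_zero,
    Module.End.one_apply, Matrix.mulVec_single_one] at h1
  · have hc : (-1 : k) ^ n * (n.descFactorial n : k) ≠ 0 := by
      rw [Nat.descFactorial_self]
      exact mul_ne_zero (pow_ne_zero _ (by simp)) (Nat.cast_ne_zero.2 (Nat.factorial_ne_zero n))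
    exact (smul_eq_zero.1 h1).resolve_left hc
  · intro s hs
    have hd : dVec k N (Pi.single j 1) = 0 := by
      ext1 r
      by_cases hr : r = j
      · subst hr; simp [dVec_apply]
      · simp [dVec_apply, hr]
    obtain ⟨m, hm⟩ : ∃ m, n - s = m + 1 :=
      ⟨n - s - 1, by have := Finset.mem_range.1 hs; omega⟩
    rw [hm, pow_succ, Module.End.mul_apply, hd, map_zero, Matrix.mulVec_zero, smul_zero]

/-- A nonzero set of conformal endomorphisms that absorbs `S` on the right has no common
nonzero null vector. -/
theorem eq_zero_of_forall_act_eq_zero [CharZero k] {S : Submodule k (CendN k N)}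
    (hirr : IsIrreducible S) {F : Set (CendN k N)}
    (hF : ∀ f ∈ F, ∀ a ∈ S, ∀ n, prod n f a ∈ F) {f : CendN k N} (hf : f ∈ F) (hf0 : f ≠ 0)
    {u : VN k N} (hu : ∀ g ∈ F, ∀ n, act g n u = 0) : u = 0 := by
  have key := hirr (⨅ g ∈ F, transporter g ⊥) (by
    intro a ha n w hw
    simp only [Submodule.mem_iInf, mem_transporter, Submodule.mem_bot] at hw ⊢
    intro g hg m
    rw [act_act]
    exact Finset.sum_eq_zero fun ij _ => by rw [hw _ (hF g hg a ha _), smul_zero])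
  rcases key with h | h
  · rw [← Submodule.mem_bot k[X], ← h]
    simpa only [Submodule.mem_iInf, mem_transporter, Submodule.mem_bot] using hu
  · refine absurd (eq_zero_of_act_eq_zero fun n w => ?_) hf0
    have hw : w ∈ ⨅ g ∈ F, transporter g ⊥ := h ▸ Submodule.mem_top
    simp only [Submodule.mem_iInf, mem_transporter, Submodule.mem_bot] at hw
    exact hw f hf n

/-! ### Elements all of whose multiples by powers of `v` lie in the subalgebra -/

theorem prod_v_pow_left (n i : ℕ) (a b : CendN k N) :
    prod n (varv k ^ i • a) b = varv k ^ i • prod n a b := by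
  induction i with
  | zero => simp
  | succ i ih => rw [pow_succ', mul_smul, prod_v_left, ih, mul_smul]

theorem dT_pow_prod {n : ℕ} {f b : CendN k N} (h : ∀ m > n, prod m f b = 0) (l : ℕ) :
    (dT k N ^ l) (prod n f b) = prod n ((dT k N ^ l) f) b := by
  induction l generalizing f with
  | zero => rfl
  | succ l ih =>
    rw [pow_succ, Module.End.mul_apply, Module.End.mul_apply, dT_prod, h _ (Nat.lt_succ_self n),
      zero_add]
    refine ih fun m hm => ?_
    have := dT_prod m f b
    rwa [h m hm, h _ (hm.trans (Nat.lt_succ_self m)), map_zero, zero_add, eq_comm] at this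

theorem dT_pow_eventually_zero (a : CendN k N) : ∃ p, (dT k N ^ p) a = 0 := by
  have hone : coeffD (1 : CendN k N) 0 = 1 := by
    ext1 i j
    simp only [coeffD, Matrix.map_apply, Matrix.one_apply]
    split_ifs <;> simp
  have hd : dT k N (1 : CendN k N) = 0 := by
    have h1 : dTotal k (1 : k[X][X]) = 0 := by simpa using dTotal_pow_C 1 (1 : k[X])
    ext1 i j
    rw [dT_apply, Matrix.one_apply]
    split_ifs <;> simp [h1]
  have h : ∀ n, prod n 1 a = (dT k N ^ n) a := by
    intro n
    induction n with
    | zero =>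
      refine ext_wcoeff fun j i => ?_
      rw [wcoeff_prod, act_zero_index, hone, Matrix.one_mulVec, pow_zero, Module.End.one_apply]
    | succ n ih =>
      rw [pow_succ', Module.End.mul_apply, ← ih, dT_prod, hd, prod_zero_left, add_zero]
  obtain ⟨M, hM⟩ := exists_prod_eq_zero 1 a
  exact ⟨M, (h M).symm.trans (hM M le_rfl)⟩

theorem wcoeff_eventually_zero (a : CendN k N) : ∃ q, ∀ j ≥ q, ∀ i, wcoeff j i a = 0 := by
  refine ⟨(Finset.univ.sup fun p : Fin N × Fin N => (swapW k (a p.1 p.2)).natDegree) + 1,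
    fun j hj i => ?_⟩
  ext1 r
  apply coeff_eq_zero_of_natDegree_lt
  have := Finset.le_sup (f := fun p : Fin N × Fin N => (swapW k (a p.1 p.2)).natDegree)
    (Finset.mem_univ (r, i))
  exact lt_of_le_of_lt this (by omega)

/-- The elements of `Cend_N` of degree less than `p` in `v` and less than `q` in `w = v - D`. -/
noncomputable def degreeBounded (k : Type*) [Field k] (N p q : ℕ) : Submodule k (CendN k N) :=
  LinearMap.ker (dT k N ^ p) ⊓ ⨅ j ≥ q, ⨅ i, LinearMap.ker (wcoeff j i)

theorem mem_degreeBounded {p q : ℕ} {a : CendN k N} :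
    a ∈ degreeBounded k N p q ↔ (dT k N ^ p) a = 0 ∧ ∀ j ≥ q, ∀ i, wcoeff j i a = 0 := by
  simp [degreeBounded]

theorem wcoeff_dT_pow (j p : ℕ) (i : Fin N) (a : CendN k N) :
    wcoeff j i ((dT k N ^ p) a) = (dVec k N ^ p) (wcoeff j i a) := by
  induction p with
  | zero => rfl
  | succ p ih => rw [pow_succ', Module.End.mul_apply, wcoeff_dT, ih, pow_succ',
      Module.End.mul_apply]

theorem coeff_wcoeff_eq_zero [CharZero k] {p : ℕ} {a : CendN k N} (ha : (dT k N ^ p) a = 0)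
    (j : ℕ) (i r : Fin N) {m : ℕ} (hm : p ≤ m) : (wcoeff j i a r).coeff m = 0 := by
  have h3 := congrFun (wcoeff_dT_pow j p i a) r
  rw [ha, map_zero, dVec_pow_apply] at h3
  have h4 := congrArg (fun f : k[X] => f.coeff (m - p)) h3
  simp only [coeff_iterate_derivative, Nat.sub_add_cancel hm, Pi.zero_apply, coeff_zero,
    nsmul_eq_mul] at h4
  refine (mul_eq_zero.1 h4.symm).resolve_left (Nat.cast_ne_zero.2 ?_)
  rw [Ne, Nat.descFactorial_eq_zero_iff_lt]
  omega

theorem finiteDimensional_degreeBounded [CharZero k] (p q : ℕ) :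
    FiniteDimensional k (degreeBounded k N p q) := by
  let φ : CendN k N →ₗ[k] (Fin q × Fin N × Fin N × Fin p → k) :=
    LinearMap.pi fun x => (lcoeff k x.2.2.2).comp
      ((LinearMap.proj x.2.2.1 : VN k N →ₗ[k] k[X]).comp (wcoeff x.1 x.2.1))
  refine Module.Finite.of_injective (φ.domRestrict (degreeBounded k N p q)) ?_
  refine (injective_iff_map_eq_zero _).2 ?_
  rintro ⟨a, ha⟩ h
  obtain ⟨h1, h2⟩ := mem_degreeBounded.1 ha
  rw [Subtype.ext_iff]
  refine ext_wcoeff fun j i => ?_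
  rw [Submodule.coe_zero, map_zero]
  by_cases hj : q ≤ j
  · exact h2 j hj i
  ext1 r
  ext1 m
  by_cases hm : p ≤ m
  · exact coeff_wcoeff_eq_zero h1 j i r hm
  · exact congrFun h (⟨j, not_le.1 hj⟩, i, r, ⟨m, not_le.1 hm⟩)

/-- The elements `f` with `f, vf, …, v^m f` in `S`. -/
noncomputable def vPowClosed (S : Submodule k (CendN k N)) (m : ℕ) : Submodule k (CendN k N) :=
  ⨅ i ≤ m, S.comap (LinearMap.lsmul k[X][X] (CendN k N) (varv k ^ i) |>.restrictScalars k)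

theorem mem_vPowClosed {S : Submodule k (CendN k N)} {m : ℕ} {f : CendN k N} :
    f ∈ vPowClosed S m ↔ ∀ i ≤ m, varv k ^ i • f ∈ S := by
  simp [vPowClosed]

/-- If `f ≠ 0` then `f` does not annihilate from the left all of the elements `b` of `S` with
`vb ∈ S` and bounded degree in `w`, because the columns of the `w`-coefficients of such `b`
generate an `S`-submodule of `V_N`. -/
theorem exists_prod_ne_zero [CharZero k] {S : Submodule k (CendN k N)}
    (hS : IsConformalSubalgebra S) (hirr : IsIrreducible S) {q : ℕ} {a : CendN k N}
    (ha : a ∈ S) (hva : varv k • a ∈ S) (hq : ∀ j ≥ q, ∀ i, wcoeff j i a = 0) (ha0 : a ≠ 0)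
    {f : CendN k N} (hf : f ≠ 0) :
    ∃ b ∈ S, varv k • b ∈ S ∧ (∀ j ≥ q, ∀ i, wcoeff j i b = 0) ∧ ∃ n, prod n f b ≠ 0 := by
  by_contra! hcon
  let G : Set (VN k N) := {u | ∃ b ∈ S, varv k • b ∈ S ∧ (∀ j ≥ q, ∀ i, wcoeff j i b = 0) ∧
    ∃ j i, wcoeff j i b = u}
  have hinv : ∀ c ∈ S, ∀ n : ℕ, ∀ u ∈ Submodule.span k[X] G,
      act c n u ∈ Submodule.span k[X] G := by
    intro c hc n u hu
    have hle : Submodule.span k[X] G ≤ transporter c (Submodule.span k[X] G) := by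
      rw [Submodule.span_le]
      rintro _ ⟨b, hb, hvb, hbq, j, i, rfl⟩
      refine mem_transporter.2 fun n => Submodule.subset_span
        ⟨prod n c b, hS.prod_mem c hc b hb n, ?_, fun j' hj' i' => ?_, j, i, wcoeff_prod j i n c b⟩
      · rw [← add_sub_cancel_right (varv k • prod n c b) ((n : k) • prod (n - 1) c b),
          ← prod_v_right]
        exact S.sub_mem (hS.prod_mem c hc _ hvb n)
          (S.smul_mem _ (hS.prod_mem c hc b hb _))
      · rw [wcoeff_prod, hbq j' hj' i']
        exact (actL c n).map_zero
    exact mem_transporter.1 (hle hu) n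
  rcases hirr _ hinv with h | h
  · refine ha0 (ext_wcoeff fun j i => ?_)
    rw [map_zero, ← Submodule.mem_bot k[X], ← h]
    exact Submodule.subset_span ⟨a, ha, hva, hq, j, i, rfl⟩
  · refine hf (eq_zero_of_act_eq_zero fun n u => ?_)
    have hle : Submodule.span k[X] G ≤ transporter f ⊥ := by
      rw [Submodule.span_le]
      rintro _ ⟨b, hb, hvb, hbq, j, i, rfl⟩
      refine mem_transporter.2 fun n => ?_
      rw [← wcoeff_prod, hcon b hb hvb hbq n, map_zero]
      exact Submodule.zero_mem _
    rw [h] at hle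
    exact (Submodule.mem_bot k[X]).1 (mem_transporter.1 (hle Submodule.mem_top) n)

/-- The highest nonzero product `f ∘ₙ b` lies one step deeper in the filtration by
`vPowClosed`, and its degrees do not exceed those of `f` in `v` and of `b` in `w`. -/
theorem exists_ne_zero_mem_vPowClosed_succ [CharZero k] {S : Submodule k (CendN k N)}
    (hS : IsConformalSubalgebra S) (hirr : IsIrreducible S) {p q : ℕ} {a : CendN k N}
    (ha : a ∈ S) (hva : varv k • a ∈ S) (hq : ∀ j ≥ q, ∀ i, wcoeff j i a = 0) (ha0 : a ≠ 0)
    {m : ℕ} {f : CendN k N} (hf : f ∈ vPowClosed S m) (hfd : f ∈ degreeBounded k N p q)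
    (hf0 : f ≠ 0) :
    ∃ g ∈ vPowClosed S (m + 1), g ∈ degreeBounded k N p q ∧ g ≠ 0 := by
  obtain ⟨b, hb, hvb, hbq, n₀, hn₀⟩ := exists_prod_ne_zero hS hirr ha hva hq ha0 hf0
  -- the highest nonzero product: only for it does `∂_D + ∂_v` act on the left factor alone
  obtain ⟨n, hn, hmax⟩ : ∃ n, prod n f b ≠ 0 ∧ ∀ l > n, prod l f b = 0 := by
    classical
    have hex := exists_prod_eq_zero f b
    have hlt : n₀ < Nat.find hex := by
      by_contra! hle
      exact hn₀ (Nat.find_spec hex n₀ hle)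
    have hmin := Nat.find_min hex (m := Nat.find hex - 1) (by omega)
    push Not at hmin
    obtain ⟨l, hl, hl0⟩ := hmin
    refine ⟨l, hl0, fun l' hl' => Nat.find_spec hex l' (by omega)⟩
  rw [mem_vPowClosed] at hf
  obtain ⟨hfp, -⟩ := mem_degreeBounded.1 hfd
  refine ⟨prod n f b, mem_vPowClosed.2 fun i hi => ?_, mem_degreeBounded.2 ⟨?_, ?_⟩, hn⟩
  · rcases Nat.le_succ_iff.1 hi with hi | rfl
    · rw [← prod_v_pow_left]
      exact hS.prod_mem _ (hf i hi) b hb n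
    · have h1 : varv k • prod n f b = prod n f (varv k • b) - (n : k) • prod (n - 1) f b := by
        rw [prod_v_right, add_sub_cancel_right]
      rw [pow_succ, mul_smul, h1, smul_sub, smul_comm (varv k ^ m) (n : k), ← prod_v_pow_left,
        ← prod_v_pow_left]
      exact S.sub_mem (hS.prod_mem _ (hf m le_rfl) _ hvb n)
        (S.smul_mem _ (hS.prod_mem _ (hf m le_rfl) b hb _))
  · rw [dT_pow_prod hmax, hfp, prod_zero_left]
  · intro j hj i
    rw [wcoeff_prod, hbq j hj i]
    exact (actL f n).map_zero

/-- A decreasing sequence of nonzero finite-dimensional subspaces has nonzero intersection. -/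
theorem exists_ne_zero_forall_mem_of_antitone {E : Type*} [AddCommGroup E] [Module k E]
    {K : ℕ → Submodule k E} [∀ m, FiniteDimensional k (K m)] (hK : Antitone K)
    (h : ∀ m, K m ≠ ⊥) : ∃ x, x ≠ 0 ∧ ∀ m, x ∈ K m := by
  let m₀ := Function.argmin fun m => Module.finrank k (K m)
  obtain ⟨x, hx, hx0⟩ := Submodule.exists_mem_ne_zero_of_ne_bot (h m₀)
  refine ⟨x, hx0, fun m => ?_⟩
  rcases le_total m m₀ with hm | hm
  · exact hK hm hx
  · rwa [Submodule.eq_of_le_of_finrank_le (hK hm)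
      (Function.argmin_le (fun m => Module.finrank k (K m)) m)]

theorem exists_forall_v_pow_smul_mem [CharZero k] {S : Submodule k (CendN k N)}
    (hS : IsConformalSubalgebra S) (hirr : IsIrreducible S) (hv : S ⊓ vMul S ≠ ⊥) :
    ∃ f : CendN k N, f ≠ 0 ∧ ∀ i : ℕ, varv k ^ i • f ∈ S := by
  obtain ⟨b, ⟨hvb, a, ha, rfl⟩, hb0⟩ := Submodule.exists_mem_ne_zero_of_ne_bot hv
  have hva : varv k • a ∈ S := hvb
  have ha0 : a ≠ 0 := by
    rintro rfl
    exact hb0 (map_zero _)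
  obtain ⟨p, hp⟩ := dT_pow_eventually_zero a
  obtain ⟨q, hq⟩ := wcoeff_eventually_zero a
  have hne : ∀ m, ∃ g ∈ vPowClosed S m, g ∈ degreeBounded k N p q ∧ g ≠ 0 := by
    intro m
    induction m with
    | zero =>
      refine ⟨a, mem_vPowClosed.2 fun i hi => ?_, mem_degreeBounded.2 ⟨hp, hq⟩, ha0⟩
      rw [Nat.le_zero.1 hi, pow_zero, one_smul]
      exact ha
    | succ m ih =>
      obtain ⟨g, hg, hgd, hg0⟩ := ih
      exact exists_ne_zero_mem_vPowClosed_succ hS hirr ha hva hq ha0 hg hgd hg0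
  have hfin := finiteDimensional_degreeBounded (k := k) (N := N) p q
  let K : ℕ → Submodule k (CendN k N) := fun m => vPowClosed S m ⊓ degreeBounded k N p q
  have hKfin : ∀ m, FiniteDimensional k (K m) := fun m =>
    Submodule.finiteDimensional_of_le (inf_le_right : K m ≤ degreeBounded k N p q)
  obtain ⟨f, hf0, hf⟩ := exists_ne_zero_forall_mem_of_antitone (K := K)
    (fun m n hmn => inf_le_inf_right _ fun g hg =>
      mem_vPowClosed.2 fun i hi => mem_vPowClosed.1 hg i (hi.trans hmn))
    (fun m hm => by
      obtain ⟨g, hg, hgd, hg0⟩ := hne m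
      exact hg0 ((Submodule.mem_bot k).1 (hm ▸ Submodule.mem_inf.2 ⟨hg, hgd⟩)))
  exact ⟨f, hf0, fun i => mem_vPowClosed.1 (hf i).1 i le_rfl⟩

/-- The largest `𝕜[v]`-submodule of `S`; it is a two-sided ideal of `S`. -/
def vCore (S : Submodule k (CendN k N)) : Set (CendN k N) := {f | ∀ i : ℕ, varv k ^ i • f ∈ S}

theorem vCore_subset {S : Submodule k (CendN k N)} {f : CendN k N} (hf : f ∈ vCore S) :
    f ∈ S := by
  simpa using hf 0

theorem v_smul_mem_vCore {S : Submodule k (CendN k N)} {f : CendN k N} (hf : f ∈ vCore S) :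
    varv k • f ∈ vCore S := fun i => by
  rw [smul_smul, ← pow_succ]
  exact hf (i + 1)

theorem prod_mem_vCore_right {S : Submodule k (CendN k N)} (hS : IsConformalSubalgebra S)
    {f a : CendN k N} (hf : f ∈ vCore S) (ha : a ∈ S) (n : ℕ) : prod n f a ∈ vCore S := fun i => by
  rw [← prod_v_pow_left]
  exact hS.prod_mem _ (hf i) a ha n

theorem prod_mem_vCore_left {S : Submodule k (CendN k N)} (hS : IsConformalSubalgebra S)
    {f a : CendN k N} (hf : f ∈ vCore S) (ha : a ∈ S) (n : ℕ) : prod n a f ∈ vCore S := fun i => by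
  induction i generalizing n f with
  | zero => simpa using hS.prod_mem a ha f (vCore_subset hf) n
  | succ i ih =>
    have h1 : varv k • prod n a f = prod n a (varv k • f) - (n : k) • prod (n - 1) a f := by
      rw [prod_v_right, add_sub_cancel_right]
    rw [pow_succ, mul_smul, h1, smul_sub, smul_comm (varv k ^ i) (n : k)]
    exact S.sub_mem (ih (v_smul_mem_vCore hf) n) (S.smul_mem _ (ih hf _))

/-- `V_N` is spanned over `𝕜` by the images of the operators from `vCore S`, restricted to any
nonzero `S`-invariant subspace `U`. -/
theorem span_act_vCore_eq_top [CharZero k] {S : Submodule k (CendN k N)}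
    (hS : IsConformalSubalgebra S) (hirr : IsIrreducible S) (hv : S ⊓ vMul S ≠ ⊥)
    {U : Submodule k (VN k N)} (hU : U ≠ ⊥) :
    Submodule.span k {w | ∃ f ∈ vCore S, ∃ n, ∃ u ∈ U, act f n u = w} = ⊤ := by
  set W := Submodule.span k {w | ∃ f ∈ vCore S, ∃ n, ∃ u ∈ U, act f n u = w} with hW
  have hX : ∀ w ∈ W, (X : k[X]) • w ∈ W := by
    intro w hw
    induction hw using Submodule.span_induction with
    | mem w hw =>
      obtain ⟨f, hf, n, u, hu, rfl⟩ := hw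
      rw [← act_v_smul]
      exact Submodule.subset_span ⟨_, v_smul_mem_vCore hf, n, u, hu, rfl⟩
    | zero => rw [smul_zero]; exact W.zero_mem
    | add x y _ _ hx hy => rw [smul_add]; exact W.add_mem hx hy
    | smul c x _ hx => rw [smul_comm]; exact W.smul_mem c hx
  have hinv : ∀ a ∈ S, ∀ n : ℕ, ∀ w ∈ submoduleOfX W hX, act a n w ∈ submoduleOfX W hX := by
    intro a ha m w hw
    have hle : W ≤ W.comap (actL a m) := by
      rw [hW, Submodule.span_le]
      rintro _ ⟨f, hf, n, u, hu, rfl⟩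
      rw [SetLike.mem_coe, Submodule.mem_comap, actL_apply, act_act]
      exact W.sum_mem fun ij _ => W.nsmul_mem
        (Submodule.subset_span ⟨_, prod_mem_vCore_left hS hf ha _, _, u, hu, rfl⟩) _
    rw [mem_submoduleOfX] at hw ⊢
    exact Submodule.mem_comap.1 (hle hw)
  obtain ⟨f, hf0, hf⟩ := exists_forall_v_pow_smul_mem hS hirr hv
  rcases hirr _ hinv with h | h
  · exfalso
    obtain ⟨u, hu, hu0⟩ := Submodule.exists_mem_ne_zero_of_ne_bot hU
    refine hu0 (eq_zero_of_forall_act_eq_zero hirr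
      (fun g hg a ha n => prod_mem_vCore_right hS hg ha n) hf hf0 fun g hg n => ?_)
    rw [← Submodule.mem_bot k[X], ← h, mem_submoduleOfX]
    exact Submodule.subset_span ⟨g, hg, n, u, hu, rfl⟩
  · refine eq_top_iff.2 fun w _ => ?_
    rw [← mem_submoduleOfX (h := hX), h]
    exact Submodule.mem_top

/-- `V_N` is irreducible under the operators `a_n`, `a ∈ S`, alone, without multiplication
by `D`. -/
theorem eq_bot_or_top_of_invariant [CharZero k] {S : Submodule k (CendN k N)}
    (hS : IsConformalSubalgebra S) (hirr : IsIrreducible S) (hv : S ⊓ vMul S ≠ ⊥)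
    {U : Submodule k (VN k N)} (hU : ∀ a ∈ S, ∀ n : ℕ, ∀ u ∈ U, act a n u ∈ U) :
    U = ⊥ ∨ U = ⊤ := by
  by_cases h0 : U = ⊥
  · exact Or.inl h0
  · right
    rw [eq_top_iff, ← span_act_vCore_eq_top hS hirr hv h0, Submodule.span_le]
    rintro _ ⟨f, hf, n, u, hu, rfl⟩
    exact hU f (vCore_subset hf) n u hu

/-! ### Schur's lemma and density -/

/-- A linear endomorphism of `V_N` that commutes with the action of `S` is a scalar.  It is
`H`-linear because `vCore S` acts, hence it has an eigenvalue on `V_N / D V_N = 𝕜^N`, and the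
corresponding shift is not bijective. -/
theorem exists_eq_smul_of_commute [CharZero k] [IsAlgClosed k] (hN : 0 < N)
    {S : Submodule k (CendN k N)} (hS : IsConformalSubalgebra S) (hirr : IsIrreducible S)
    (hv : S ⊓ vMul S ≠ ⊥) {φ : VN k N →ₗ[k] VN k N}
    (hφ : ∀ a ∈ S, ∀ n u, φ (act a n u) = act a n (φ u)) : ∃ c : k, ∀ u, φ u = c • u := by
  have : Nonempty (Fin N) := ⟨⟨0, hN⟩⟩
  have htop : (⊤ : Submodule k (VN k N)) ≠ ⊥ := top_ne_bot
  have hX : ∀ u, φ ((X : k[X]) • u) = (X : k[X]) • φ u := by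
    intro u
    have hu : u ∈ Submodule.span k
        {w | ∃ f ∈ vCore S, ∃ n, ∃ u ∈ (⊤ : Submodule k (VN k N)), act f n u = w} := by
      rw [span_act_vCore_eq_top hS hirr hv htop]
      exact Submodule.mem_top
    induction hu using Submodule.span_induction with
    | mem w hw =>
      obtain ⟨f, hf, n, u, -, rfl⟩ := hw
      rw [← act_v_smul, hφ _ (vCore_subset (v_smul_mem_vCore hf)), hφ _ (vCore_subset hf),
        act_v_smul]
    | zero => simp
    | add x y _ _ hx hy => rw [smul_add, map_add, map_add, smul_add, hx, hy]
    | smul c x _ hx => rw [smul_comm, φ.map_smul, φ.map_smul, hx, smul_comm]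
  let ev : VN k N →ₗ[k] (Fin N → k) := LinearMap.pi fun i => (lcoeff k 0).comp (LinearMap.proj i)
  let co : (Fin N → k) →ₗ[k] VN k N :=
    LinearMap.pi fun i => (CAlgHom (R := k) (A := k)).toLinearMap.comp (LinearMap.proj i)
  have hev : ∀ u : VN k N, ev ((X : k[X]) • u) = 0 := by
    intro u
    ext1 i
    simp [ev]
  have hevco : ∀ x, ev (co x) = x := by
    intro x
    ext1 i
    simp [ev, co]
  have hdiv : ∀ u : VN k N, ev u = 0 → ∃ w : VN k N, u = (X : k[X]) • w := by
    intro u hu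
    refine ⟨fun i => divX (u i), ?_⟩
    ext1 i
    have h0 : (u i).coeff 0 = 0 := congrFun hu i
    have h1 := X_mul_divX_add (u i)
    rw [h0, C_0, add_zero] at h1
    exact h1.symm
  -- `ev ∘ φ ∘ co` is the map induced by `φ` on `V_N / D V_N`
  obtain ⟨c, hc⟩ := Module.End.exists_eigenvalue (ev ∘ₗ φ ∘ₗ co)
  obtain ⟨x, hx⟩ := hc.exists_hasEigenvector
  have hx1 : ev (φ (co x)) = c • x := hx.apply_eq_smul
  let ψ : VN k N →ₗ[k] VN k N := φ - c • LinearMap.id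
  have hψ_apply : ∀ u, ψ u = φ u - c • u := fun u => rfl
  have hψ : ∀ a ∈ S, ∀ n u, ψ (act a n u) = act a n (ψ u) := by
    intro a ha n u
    rw [hψ_apply, hψ_apply, hφ a ha, ← actL_apply, ← actL_apply, ← actL_apply, map_sub, map_smul]
  refine ⟨c, fun u => sub_eq_zero.1 ?_⟩
  by_contra hne
  have hker : LinearMap.ker ψ = ⊥ := by
    refine (eq_bot_or_top_of_invariant hS hirr hv (U := LinearMap.ker ψ) ?_).resolve_right ?_
    · intro a ha n w hw
      rw [LinearMap.mem_ker, hψ a ha, LinearMap.mem_ker.1 hw]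
      exact (actL a n).map_zero
    · intro h
      exact hne (LinearMap.mem_ker.1 (h ▸ Submodule.mem_top : u ∈ LinearMap.ker ψ))
  have hran : LinearMap.range ψ = ⊤ := by
    refine (eq_bot_or_top_of_invariant hS hirr hv (U := LinearMap.range ψ) ?_).resolve_left ?_
    · rintro a ha n _ ⟨w, rfl⟩
      exact ⟨act a n w, hψ a ha n w⟩
    · intro h
      exact hne ((Submodule.mem_bot k).1
        (h ▸ LinearMap.mem_range_self ψ u : ψ u ∈ (⊥ : Submodule k _)))
  obtain ⟨w, hw⟩ := hdiv (ψ (co x)) (by rw [hψ_apply, map_sub, map_smul, hx1, hevco, sub_self])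
  obtain ⟨w', rfl⟩ := LinearMap.range_eq_top.1 hran w
  have hco : co x = (X : k[X]) • w' := by
    apply LinearMap.ker_eq_bot.1 hker
    rw [hw, hψ_apply, hψ_apply, hX, smul_sub, smul_comm c (X : k[X])]
  apply hx.2
  rw [← hevco x, hco, hev]

/-- The algebra of operators on `V_N` generated by all `a_n` with `a ∈ S`. -/
noncomputable def operatorAlgebra (S : Submodule k (CendN k N)) :
    Subalgebra k (Module.End k (VN k N)) :=
  Algebra.adjoin k {φ | ∃ a ∈ S, ∃ n, actL a n = φ}

theorem actL_mem_operatorAlgebra {S : Submodule k (CendN k N)} {a : CendN k N} (ha : a ∈ S)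
    (n : ℕ) : actL a n ∈ operatorAlgebra S :=
  Algebra.subset_adjoin ⟨a, ha, n, rfl⟩

theorem isSimpleModule_operatorAlgebra [CharZero k] (hN : 0 < N)
    {S : Submodule k (CendN k N)} (hS : IsConformalSubalgebra S) (hirr : IsIrreducible S)
    (hv : S ⊓ vMul S ≠ ⊥) : IsSimpleModule (operatorAlgebra S) (VN k N) := by
  have : Nonempty (Fin N) := ⟨⟨0, hN⟩⟩
  refine (isSimpleModule_iff _ _).2 { exists_pair_ne := ⟨⊥, ⊤, bot_ne_top⟩, eq_bot_or_eq_top := ?_ }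
  intro U
  have hmem : ∀ u, u ∈ U.restrictScalars k ↔ u ∈ U := fun u => Iff.rfl
  rcases eq_bot_or_top_of_invariant hS hirr hv (U := U.restrictScalars k)
    (fun a ha n u hu => U.smul_mem ⟨actL a n, actL_mem_operatorAlgebra ha n⟩ hu) with h | h
  · left
    rw [eq_bot_iff]
    intro u hu
    rwa [← hmem, h] at hu
  · right
    rw [eq_top_iff]
    intro u _
    rw [← hmem, h]
    exact Submodule.mem_top

theorem exists_smul_eq_of_commute_end {R M : Type*} [Ring R] [AddCommGroup M] [Module R M]
    [IsSemisimpleModule R M] (ψ : M →+ M) (h : ∀ (φ : Module.End R M) (m : M), ψ (φ m) = φ (ψ m))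
    (s : Finset M) : ∃ r : R, ∀ m ∈ s, ψ m = r • m :=
  jacobson_density { ψ with map_smul' := h } s

/-- The operators generated by `S` are dense in all linear operators on `V_N`. -/
theorem exists_mem_operatorAlgebra_eq_on [CharZero k] [IsAlgClosed k] (hN : 0 < N)
    {S : Submodule k (CendN k N)} (hS : IsConformalSubalgebra S) (hirr : IsIrreducible S)
    (hv : S ⊓ vMul S ≠ ⊥) (ψ : VN k N →ₗ[k] VN k N) (s : Finset (VN k N)) :
    ∃ r ∈ operatorAlgebra S, ∀ u ∈ s, ψ u = r u := by
  have := isSimpleModule_operatorAlgebra hN hS hirr hv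
  obtain ⟨r, hr⟩ := exists_smul_eq_of_commute_end (R := operatorAlgebra S) ψ.toAddMonoidHom
    (fun φ u => by
      obtain ⟨c, hc⟩ := exists_eq_smul_of_commute hN hS hirr hv
        (φ := φ.restrictScalars k) (fun a ha n u =>
          φ.map_smul (⟨actL a n, actL_mem_operatorAlgebra ha n⟩ : operatorAlgebra S) u)
      have hc' : ∀ u, φ u = c • u := hc
      simp only [LinearMap.toAddMonoidHom_coe, hc', map_smul]) s
  exact ⟨r, r.2, hr⟩

/-- `S` is stable under every linear operator on `V_N`, acting on the coefficients of the
powers of `w`. -/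
theorem mem_of_wcoeff_eq [CharZero k] [IsAlgClosed k] (hN : 0 < N)
    {S : Submodule k (CendN k N)} (hS : IsConformalSubalgebra S) (hirr : IsIrreducible S)
    (hv : S ⊓ vMul S ≠ ⊥) (ψ : VN k N →ₗ[k] VN k N) {a b : CendN k N} (ha : a ∈ S)
    (hab : ∀ j i, wcoeff j i b = ψ (wcoeff j i a)) : b ∈ S := by
  classical
  obtain ⟨q, hq⟩ := wcoeff_eventually_zero a
  obtain ⟨r, hr, hrs⟩ := exists_mem_operatorAlgebra_eq_on hN hS hirr hv ψ
    ((Finset.range q ×ˢ Finset.univ).image fun x : ℕ × Fin N => wcoeff x.1 x.2 a)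
  have hr' : ∀ r ∈ operatorAlgebra S,
      ∀ a ∈ S, ∃ b' ∈ S, ∀ j i, wcoeff j i b' = r (wcoeff j i a) := by
    intro r hr
    induction hr using Algebra.adjoin_induction with
    | mem φ hφ =>
      obtain ⟨c, hc, n, rfl⟩ := hφ
      exact fun a ha => ⟨prod n c a, hS.prod_mem c hc a ha n, fun j i => wcoeff_prod j i n c a⟩
    | algebraMap c =>
      exact fun a ha => ⟨c • a, S.smul_mem c ha, fun j i => map_smul _ _ _⟩
    | add x y _ _ hx hy =>
      intro a ha
      obtain ⟨b₁, hb₁, h₁⟩ := hx a ha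
      obtain ⟨b₂, hb₂, h₂⟩ := hy a ha
      exact ⟨b₁ + b₂, S.add_mem hb₁ hb₂, fun j i => by
        rw [map_add, h₁, h₂, LinearMap.add_apply]⟩
    | mul x y _ _ hx hy =>
      intro a ha
      obtain ⟨b₁, hb₁, h₁⟩ := hy a ha
      obtain ⟨b₂, hb₂, h₂⟩ := hx b₁ hb₁
      exact ⟨b₂, hb₂, fun j i => by rw [h₂, h₁, Module.End.mul_apply]⟩
  obtain ⟨b', hb', h⟩ := hr' r hr a ha
  convert hb'
  refine ext_wcoeff fun j i => ?_
  rw [hab, h]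
  by_cases hj : q ≤ j
  · rw [hq j hj i, map_zero, map_zero]
  · exact hrs _ (Finset.mem_image.2 ⟨(j, i), by simpa using hj, rfl⟩)

/-! ### Rank one elements -/

/-- The element `u(v) e(w)` of `Cend_N`, where `u` is a column, `e` is a row and `w = v - D`. -/
noncomputable def rankOne (u e : VN k N) : CendN k N :=
  Matrix.of fun r i => C (u r) * aeval (-varD k + varv k) (e i)

theorem rankOne_apply (u e : VN k N) (r i : Fin N) :
    rankOne u e r i = C (u r) * aeval (-varD k + varv k) (e i) := rfl

theorem swapW_aeval (f : k[X]) : swapW k (aeval (-varD k + varv k) f) = f.map C := by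
  have h : ((swapW k).restrictScalars k) (-varD k + varv k) = X := by
    simp only [AlgHom.restrictScalars_apply, swapW, varD, varv, map_add, map_neg, aeval_X, aeval_C]
    rw [← C_eq_algebraMap]
    ring
  have h1 := aeval_algHom_apply ((swapW k).restrictScalars k) (-varD k + varv k) f
  rw [h, aeval_X_left_eq_map] at h1
  exact h1.symm

theorem wcoeff_rankOne (j : ℕ) (i : Fin N) (u e : VN k N) :
    wcoeff j i (rankOne u e) = (e i).coeff j • u := by
  ext1 r
  rw [wcoeff_apply, rankOne_apply, swapW_C_mul, swapW_aeval, coeff_C_mul, coeff_map, Pi.smul_apply,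
    smul_eq_C_mul, mul_comm]

theorem coeff_zero_aeval (f : k[X]) : (aeval (-varD k + varv k) f).coeff 0 = f := by
  let ε : k[X][X] →ₐ[k] k[X] := (aeval (0 : k[X])).restrictScalars k
  have h : ε (-varD k + varv k) = X := by
    simp [ε, varD, varv]
  have h1 := aeval_algHom_apply ε (-varD k + varv k) f
  rw [h, aeval_X_left_apply] at h1
  rw [coeff_zero_eq_aeval_zero]
  exact h1.symm

theorem dT_rankOne (u e : VN k N) : dT k N (rankOne u e) = rankOne (dVec k N u) e :=
  ext_wcoeff fun j i => by rw [wcoeff_dT, wcoeff_rankOne, wcoeff_rankOne, map_smul]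

theorem act_rankOne (x e : VN k N) (n : ℕ) (u : VN k N) :
    act (rankOne x e) n u = (derivative^[n] (e ⬝ᵥ u)) • x := by
  induction n generalizing x with
  | zero =>
    have h : coeffD (rankOne x e) 0 = Matrix.vecMulVec x e := by
      ext1 r i
      rw [coeffD, Matrix.map_apply, rankOne_apply, coeff_C_mul, coeff_zero_aeval,
        Matrix.vecMulVec_apply]
    rw [act_zero_index, h, Matrix.vecMulVec_mulVec]
    ext1 r
    simp [mul_comm]
  | succ n ih =>
    rw [act_succ, ih, dT_rankOne, ih, Function.iterate_succ_apply']
    ext1 r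
    simp [dVec_apply]

theorem rankOne_mul_shift (u e : VN k N) (Q : Matrix (Fin N) (Fin N) k[X]) :
    rankOne u e * shift Q = rankOne u (Matrix.vecMul e Q) := by
  ext1 r i
  simp only [Matrix.mul_apply, rankOne_apply, shift, Matrix.map_apply, Matrix.vecMul, dotProduct,
    map_sum, map_mul, Finset.mul_sum, mul_assoc]

theorem varD_smul_rankOne (u e : VN k N) :
    varD k • rankOne u e = varv k • rankOne u e - rankOne u ((X : k[X]) • e) := by
  ext1 r i
  simp only [Matrix.smul_apply, Matrix.sub_apply, rankOne_apply, Pi.smul_apply, smul_eq_mul,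
    map_mul, aeval_X]
  ring

theorem rankOne_add_right (u e e' : VN k N) :
    rankOne u (e + e') = rankOne u e + rankOne u e' := by
  ext1 r i
  simp [rankOne_apply, mul_add]

theorem rankOne_smul_right (c : k) (u e : VN k N) :
    rankOne u (c • e) = c • rankOne u e := by
  ext1 r i
  simp [rankOne_apply]

theorem varv_smul_rankOne (u e : VN k N) :
    varv k • rankOne u e = rankOne ((X : k[X]) • u) e := by
  ext1 r i
  simp [rankOne_apply, varv, mul_assoc]

/-- The coefficient of `v^m` in the `r`-th row of `a(v, w)`. -/
noncomputable def rowCoeff (r : Fin N) (m : ℕ) (a : CendN k N) : VN k N := fun i =>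
  ∑ j ∈ (swapW k (a r i)).support, monomial j (((swapW k (a r i)).coeff j).coeff m)

theorem coeff_rowCoeff (r : Fin N) (m : ℕ) (a : CendN k N) (i : Fin N) (j : ℕ) :
    (rowCoeff r m a i).coeff j = (wcoeff j i a r).coeff m := by
  simp only [rowCoeff, wcoeff_apply, finsetSum_coeff, coeff_monomial, Finset.sum_ite_eq',
    mem_support_iff]
  split_ifs <;> simp_all

theorem exists_eq_sum_rankOne [CharZero k] (a : CendN k N) : ∃ p,
    a = ∑ r, ∑ m ∈ Finset.range p, rankOne (Pi.single r (X ^ m)) (rowCoeff r m a) := by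
  obtain ⟨p, hp⟩ := dT_pow_eventually_zero a
  refine ⟨p, ext_wcoeff fun j i => ?_⟩
  ext1 r
  simp only [map_sum, wcoeff_rankOne, coeff_rowCoeff, Finset.sum_apply, Pi.smul_apply]
  rw [Finset.sum_eq_single r]
  · simp only [Pi.single_eq_same]
    ext1 m
    simp only [finsetSum_coeff, coeff_smul, coeff_X_pow, smul_eq_mul, mul_ite, mul_one, mul_zero,
      Finset.sum_ite_eq, Finset.mem_range]
    split_ifs with h
    · rfl
    · exact coeff_wcoeff_eq_zero hp j i r (not_lt.1 h)
  · intro r' _ hr'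
    simp [Pi.single_eq_of_ne hr'.symm]
  · simp

/-! ### The row module of a subalgebra -/

/-- The rows `e` with `V_N ⊗ e(w) ⊆ S`. -/
noncomputable def rowModule (S : Submodule k (CendN k N)) (hD : ∀ a ∈ S, varD k • a ∈ S) :
    Submodule k[X] (VN k N) :=
  submoduleOfX
    { carrier := {e | ∀ u, rankOne u e ∈ S}
      add_mem' := fun he he' u => by
        rw [rankOne_add_right]
        exact S.add_mem (he u) (he' u)
      zero_mem' := fun u => by
        have h := rankOne_smul_right (0 : k) u 0
        rw [zero_smul, zero_smul] at h
        rw [h]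
        exact S.zero_mem
      smul_mem' := fun c e he u => by
        rw [rankOne_smul_right]
        exact S.smul_mem c (he u) }
    fun e he u => by
      have h := varD_smul_rankOne u e
      rw [eq_sub_iff_add_eq, ← eq_sub_iff_add_eq', varv_smul_rankOne] at h
      rw [h]
      exact S.sub_mem (he _) (hD _ (he u))

theorem mem_rowModule {S : Submodule k (CendN k N)} {hD : ∀ a ∈ S, varD k • a ∈ S}
    {e : VN k N} : e ∈ rowModule S hD ↔ ∀ u, rankOne u e ∈ S := Iff.rfl

theorem rowCoeff_mem_rowModule [CharZero k] [IsAlgClosed k] (hN : 0 < N)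
    {S : Submodule k (CendN k N)} (hS : IsConformalSubalgebra S) (hirr : IsIrreducible S)
    (hv : S ⊓ vMul S ≠ ⊥) {a : CendN k N} (ha : a ∈ S) (r : Fin N) (m : ℕ) :
    rowCoeff r m a ∈ rowModule S hS.D_mem := by
  rw [mem_rowModule]
  intro u
  refine mem_of_wcoeff_eq hN hS hirr hv
    (((lcoeff k m).comp (LinearMap.proj r : VN k N →ₗ[k] k[X])).smulRight u) ha fun j i => ?_
  rw [wcoeff_rankOne, coeff_rowCoeff]
  rfl

/-- A submodule of `𝕜[X]^N` is the row space of an `N × N` matrix. -/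
theorem exists_matrix_row_span (E : Submodule k[X] (VN k N)) :
    ∃ Q : Matrix (Fin N) (Fin N) k[X], ∀ e, e ∈ E ↔ ∃ c, Matrix.vecMul c Q = e := by
  obtain ⟨n, b⟩ := Submodule.basisOfPid (Pi.basisFun k[X] (Fin N)) E
  have hn : n ≤ N := by
    have h1 := Submodule.finrank_le E
    rwa [Module.finrank_eq_card_basis b, Module.finrank_fin_fun, Fintype.card_fin] at h1
  -- the rows beyond the rank of `E` are zero
  let g : Fin N → VN k N := fun l => if h : (l : ℕ) < n then (b ⟨l, h⟩ : VN k N) else 0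
  have hspan : Submodule.span k[X] (Set.range g) = E := by
    apply le_antisymm
    · rw [Submodule.span_le]
      rintro _ ⟨l, rfl⟩
      by_cases h : (l : ℕ) < n
      · simp only [g, h, dif_pos]
        exact (b ⟨l, h⟩).2
      · simp only [g, h, dif_neg, not_false_eq_true]
        exact E.zero_mem
    · intro e he
      have h1 := congrArg (Submodule.subtype E) (b.sum_repr ⟨e, he⟩)
      simp only [map_sum, map_smul, Submodule.subtype_apply] at h1
      rw [← h1]
      refine Submodule.sum_mem _ fun l _ => Submodule.smul_mem _ _ (Submodule.subset_span
        ⟨⟨l, l.2.trans_le hn⟩, ?_⟩)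
      simp [g]
  refine ⟨Matrix.of g, fun e => ?_⟩
  rw [← hspan, Submodule.mem_span_range_iff_exists_fun]
  refine exists_congr fun c => Eq.congr_left ?_
  rw [Matrix.vecMul_eq_sum]
  rfl

end CendN

theorem theorem5p3p2 (k : Type*) [Field k] [CharZero k] [IsAlgClosed k] (N : ℕ) (hN : 0 < N)
    (S : Submodule k (CendN k N)) (hS : CendN.IsConformalSubalgebra S)
    (hirr : CendN.IsIrreducible S) (hv : S ⊓ CendN.vMul S ≠ ⊥) :
    ∃ Q : Matrix (Fin N) (Fin N) (Polynomial k), Q.det ≠ 0 ∧ S = CendN.leftIdeal Q := by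
  open CendN in
  obtain ⟨Q, hQ⟩ := exists_matrix_row_span (rowModule S hS.D_mem)
  have hrow := fun {a} (ha : a ∈ S) r m => rowCoeff_mem_rowModule hN hS hirr hv ha r m
  refine ⟨Q, fun hdet => ?_, le_antisymm (fun a ha => ?_) ?_⟩
  · -- a null vector of `Q` would be annihilated by all of `S`
    obtain ⟨u, hu0, hu⟩ := Matrix.exists_mulVec_eq_zero_iff.2 hdet
    obtain ⟨f, hf0, hf⟩ := exists_forall_v_pow_smul_mem hS hirr hv
    refine hu0 (eq_zero_of_forall_act_eq_zero hirr (F := (S : Set (CendN k N)))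
      (fun g hg a ha n => hS.prod_mem g hg a ha n) (vCore_subset hf) hf0 fun g hg n => ?_)
    obtain ⟨p, hp⟩ := exists_eq_sum_rankOne g
    have hmem : g ∈ LinearMap.ker
        ({ toFun := fun a => act a n u
           map_add' := fun a b => act_add_left a b n u
           map_smul' := fun c a => act_smul_left c a n u } : CendN k N →ₗ[k] VN k N) := by
      rw [hp]
      refine Submodule.sum_mem _ fun r _ => Submodule.sum_mem _ fun m _ => ?_
      obtain ⟨c, hc⟩ := (hQ _).1 (hrow hg r m)
      change act _ n u = 0
      rw [← hc, act_rankOne, ← Matrix.dotProduct_mulVec, hu, dotProduct_zero,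
        iterate_derivative_zero, zero_smul]
    exact hmem
  · obtain ⟨p, hp⟩ := exists_eq_sum_rankOne a
    rw [hp]
    refine Submodule.sum_mem _ fun r _ => Submodule.sum_mem _ fun m _ => ?_
    obtain ⟨c, hc⟩ := (hQ _).1 (hrow ha r m)
    exact ⟨rankOne (Pi.single r (X ^ m)) c, by rw [← hc]; exact rankOne_mul_shift _ _ _⟩
  · rintro _ ⟨b, rfl⟩
    obtain ⟨p, hp⟩ := exists_eq_sum_rankOne b
    rw [LinearMap.mulRight_apply, hp, Finset.sum_mul]
    refine S.sum_mem fun r _ => ?_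
    rw [Finset.sum_mul]
    refine S.sum_mem fun m _ => ?_
    rw [rankOne_mul_shift]
    exact mem_rowModule.1 ((hQ _).2 ⟨_, rfl⟩) _
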